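/- Let $n\ge 1$ and equip $\{0,1\}^n$ with the uniform probability measure, with expectation $\mathbb E$; write $y\sim x$ if $x$ and $y$ differ in exactly one coordinate. All logarithms are natural and $0\log 0=0$. For $g\colon\{0,1\}^n\to[0,\infty)$ let $\mathrm{Ent}(g)=\mathbb E[g\log g]-\mathbb E g\cdot\log\mathbb E g$. Let $H(p)=-p\log p-(1-p)\log(1-p)$, and let $H^{-1}\colon[0,\log 2]\to[0,1/2]$ be the inverse of the restriction of $H$ to $[0,1/2]$. Define $C$ on $[0,\log 2]$ by $$C(x)=\frac4x\left(\frac12-\sqrt{H^{-1}(\log 2-x)\bigl(1-H^{-1}(\log 2-x)\bigr)}\right)\quad(0<x\le\log 2),\qquad C(0)=2 .$$ 1. Let $f\colon\{0,1\}^n\to\mathbb R$ be a non-zero function and let $\rho=\frac1n\,\frac{\mathrm{Ent}(f^2)}{\mathbb E f^2}$. Then $\rho\in[0,\log 2]$ and $$\mathbb E_x\sum_{y\sim x}(f(x)-f(y))^2\ \ge\ C(\rho)\cdot\mathrm{Ent}(f^2).$$ 2. The function $C$ is strictly increasing and convex on $[0,\log 2]$, maps this interval onto $[2,2/\log 2]$,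 and satisfies $\lim_{x\to0^+}C(x)=2$ (so that $C(0)=2$ is the limit value). -/

import Mathlib

open scoped Topology

noncomputable section

namespace HammingCube

/-- The Hamming cube `{0,1}^n`. -/
abbrev Cube (n : ℕ) : Type := Fin n → Bool

/-- Expectation with respect to the uniform measure on the cube. -/
def expect {n : ℕ} (g : Cube n → ℝ) : ℝ := (∑ x, g x) / 2 ^ n

/-- The neighbours of `x`: the vertices that differ from `x` in exactly one coordinate. -/
def neighbors {n : ℕ} (x : Cube n) : Finset (Cube n) :=
  Finset.univ.filter (fun y => hammingDist x y = 1)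

/-- The variation (Dirichlet form) `E_x ∑_{y ∼ x} (f x - f y)^2`. -/
def variation {n : ℕ} (f : Cube n → ℝ) : ℝ :=
  expect fun x => ∑ y ∈ neighbors x, (f x - f y) ^ 2

/-- The entropy `Ent g = E (g log g) - (E g) log (E g)` of a nonnegative function, with natural
logarithms and the convention `0 log 0 = 0` (which holds for `Real.log`). -/
def ent {n : ℕ} (g : Cube n → ℝ) : ℝ :=
  expect (fun x => g x * Real.log (g x)) - expect g * Real.log (expect g)

/-- The normalized entropy `ρ = (1/n) * Ent (f^2) / E (f^2)`. -/
def rho {n : ℕ} (f : Cube n → ℝ) : ℝ :=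
  1 / (n : ℝ) * (ent (fun x => f x ^ 2) / expect (fun x => f x ^ 2))

/-- The inverse `[0, log 2] → [0, 1/2]` of the natural-logarithm binary entropy function
`H x = - x log x - (1 - x) log (1 - x)` restricted to `[0, 1/2]`. -/
def entropyInv (y : ℝ) : ℝ := Function.invFunOn Real.binEntropy (Set.Icc 0 2⁻¹) y

theorem entropyInv_spec {y : ℝ} (hy : y ∈ Set.Icc 0 (Real.log 2)) :
    entropyInv y ∈ Set.Icc (0 : ℝ) 2⁻¹ ∧ Real.binEntropy (entropyInv y) = y := by
  have h : y ∈ Real.binEntropy '' Set.Icc 0 2⁻¹ := by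
    apply intermediate_value_Icc (by norm_num) Real.binEntropy_continuous.continuousOn
    simpa using hy
  exact ⟨Function.invFunOn_mem h, Function.invFunOn_eq h⟩

/-- The function `C x = (4/x) (1/2 - √(H⁻¹(log 2 - x) (1 - H⁻¹(log 2 - x))))` on `[0, log 2]`,
where the value at `0` is the limit value `2`. -/
def C (x : ℝ) : ℝ :=
  if x = 0 then 2
  else 4 / x * (1 / 2 -
    √(entropyInv (Real.log 2 - x) * (1 - entropyInv (Real.log 2 - x))))

end HammingCube

end

noncomputable section

namespace HammingCube

open Real Set Filter

/-! The curve `x ↦ x * C x` is parametrized by `u ≥ 0` through the bias `p = (1 - tanh u) / 2`: `x =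
relEnt u` and `x * C x = energy u`, so `C` becomes `energy / relEnt`. In the variable `relEnt`, the
energy has slope `2 sinh u / u` and increasing second derivative. Hence `energy / relEnt` has
positive, increasing slope, which gives monotonicity and convexity of `C` (`ratio_support`,
`exists_support_C`).

For the inequality on the cube, `x * C x` is replaced by an affine minorant `a * x + b`, because
affine bounds tensorize. Splitting off a coordinate, the chain rule for entropy leaves a two-point
entropy of the mean squares on the two halves. The two-point inequality bounds it by the squared
difference of their `L²` norms, hence by the energy across the cut (`affine_le_variation`). Tangents
to `x * C x` at points approaching `rho f` from below then give the sharp bound. -/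

/-- The divergence `log 2 - H p` at the bias `p = (1 - tanh u) / 2`. -/
def relEnt (u : ℝ) : ℝ := u * (sinh u / cosh u) - log (cosh u)

/-- The two-point Dirichlet energy `2 - 4 √(p (1 - p))` at the bias `p = (1 - tanh u) / 2`. -/
def energy (u : ℝ) : ℝ := 2 * (1 - 1 / cosh u)

/-- The derivative of `energy` with respect to `relEnt`, which is `2 sinh u / u`. -/
def energySlope (u : ℝ) : ℝ := 2 * dslope sinh 0 u

/-- The second derivative of `energy` with respect to `relEnt`. -/
def energyCurv (u : ℝ) : ℝ := 2 * cosh u ^ 2 * ((u * cosh u - sinh u) / u ^ 3)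

/-- The gap `relEnt * energySlope - energy` between the tangent line and the energy. -/
def tangentGap (u : ℝ) : ℝ := relEnt u * energySlope u - energy u

/-- The derivative of `energy / relEnt` with respect to `relEnt`. -/
def ratioSlope (u : ℝ) : ℝ := tangentGap u / relEnt u ^ 2

/-! ### Calculus in the parameter `u`. -/

theorem energySlope_of_ne {u : ℝ} (hu : u ≠ 0) : energySlope u = 2 * sinh u / u := by
  simp [energySlope, dslope_of_ne _ hu, slope_def_field]; ring

theorem energySlope_zero : energySlope 0 = 2 := by
  simp [energySlope]

theorem continuous_energySlope : Continuous energySlope := by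
  refine continuous_const.mul (continuous_iff_continuousAt.2 fun u => ?_)
  rcases eq_or_ne u 0 with rfl | hu
  · exact continuousAt_dslope_same.2 differentiableAt_sinh
  · exact (continuousAt_dslope_of_ne hu).2 continuous_sinh.continuousAt

theorem hasDerivAt_relEnt (u : ℝ) : HasDerivAt relEnt (u / cosh u ^ 2) u := by
  have hc := (cosh_pos u).ne'
  have h := ((hasDerivAt_id u).mul ((hasDerivAt_sinh u).div (hasDerivAt_cosh u) hc)).sub
    ((hasDerivAt_cosh u).log hc)
  refine h.congr_deriv ?_
  have := cosh_sq u
  simp only [id, Pi.div_apply]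
  field_simp
  linear_combination u * this

theorem hasDerivAt_energy (u : ℝ) : HasDerivAt energy (2 * sinh u / cosh u ^ 2) u := by
  have hc := (cosh_pos u).ne'
  have h := (((hasDerivAt_const u (1 : ℝ)).div (hasDerivAt_cosh u) hc).const_sub 1).const_mul 2
  refine h.congr_deriv ?_
  ring

theorem hasDerivAt_energySlope {u : ℝ} (hu : u ≠ 0) :
    HasDerivAt energySlope (energyCurv u * (u / cosh u ^ 2)) u := by
  have hc := (cosh_pos u).ne'
  have h := ((hasDerivAt_sinh u).const_mul 2).div (hasDerivAt_id u) hu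
  refine (h.congr_of_eventuallyEq ?_).congr_deriv ?_
  · filter_upwards [isOpen_ne.mem_nhds hu] with v hv
    simp [energySlope_of_ne hv]
  · simp only [id, energyCurv]
    field_simp

theorem continuous_relEnt : Continuous relEnt :=
  continuous_iff_continuousAt.2 fun u => (hasDerivAt_relEnt u).continuousAt

theorem continuous_energy : Continuous energy :=
  continuous_iff_continuousAt.2 fun u => (hasDerivAt_energy u).continuousAt

theorem relEnt_zero : relEnt 0 = 0 := by simp [relEnt]

theorem energy_zero : energy 0 = 0 := by simp [energy]

theorem strictMonoOn_relEnt : StrictMonoOn relEnt (Ici 0) := by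
  refine strictMonoOn_of_deriv_pos (convex_Ici 0) continuous_relEnt.continuousOn fun u hu => ?_
  rw [interior_Ici] at hu
  rw [(hasDerivAt_relEnt u).deriv]
  exact div_pos hu (by positivity)

theorem relEnt_pos {u : ℝ} (hu : 0 < u) : 0 < relEnt u := by
  simpa [relEnt_zero] using strictMonoOn_relEnt (mem_Ici.2 le_rfl) (mem_Ici.2 hu.le) hu

theorem mul_cosh_sub_sinh_pos {u : ℝ} (hu : 0 < u) : 0 < u * cosh u - sinh u := by
  have hd (v : ℝ) : HasDerivAt (fun v => v * cosh v - sinh v) (v * sinh v) v := by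
    refine (((hasDerivAt_id v).mul (hasDerivAt_cosh v)).sub (hasDerivAt_sinh v)).congr_deriv ?_
    simp
  have h : StrictMonoOn (fun v => v * cosh v - sinh v) (Ici 0) := by
    refine strictMonoOn_of_deriv_pos (convex_Ici 0)
      (fun v _ => (hd v).continuousAt.continuousWithinAt) fun v hv => ?_
    rw [interior_Ici] at hv
    rw [(hd v).deriv]
    exact mul_pos hv (sinh_pos_iff.2 hv)
  simpa using h (mem_Ici.2 le_rfl) (mem_Ici.2 hu.le) hu

theorem energyCurv_pos {u : ℝ} (hu : 0 < u) : 0 < energyCurv u := by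
  have := mul_cosh_sub_sinh_pos hu
  unfold energyCurv
  positivity

/-- This is the numerator of the derivative of `(v * cosh v - sinh v) / v ^ 3`; it vanishes at `0`
and its derivative is `v * (v * cosh v - sinh v)`. -/
theorem sq_mul_sinh_sub_nonneg {u : ℝ} (hu : 0 ≤ u) :
    0 ≤ u ^ 2 * sinh u - 3 * (u * cosh u - sinh u) := by
  have hd (v : ℝ) : HasDerivAt (fun v => v ^ 2 * sinh v - 3 * (v * cosh v - sinh v))
      (v * (v * cosh v - sinh v)) v := by
    refine ((((hasDerivAt_pow 2 v)).mul (hasDerivAt_sinh v)).sub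
      ((((hasDerivAt_id v).mul (hasDerivAt_cosh v)).sub
        (hasDerivAt_sinh v)).const_mul 3)).congr_deriv ?_
    simp; ring
  have h : MonotoneOn (fun v => v ^ 2 * sinh v - 3 * (v * cosh v - sinh v)) (Ici 0) := by
    refine monotoneOn_of_deriv_nonneg (convex_Ici 0)
      (fun v _ => (hd v).continuousAt.continuousWithinAt)
      (fun v _ => (hd v).differentiableAt.differentiableWithinAt) fun v hv => ?_
    rw [interior_Ici] at hv
    rw [(hd v).deriv]
    exact mul_nonneg (le_of_lt hv) (mul_cosh_sub_sinh_pos hv).le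
  simpa using h (mem_Ici.2 le_rfl) (mem_Ici.2 hu) hu

theorem monotoneOn_energyCurv : MonotoneOn energyCurv (Ioi 0) := by
  have hd (v : ℝ) (hv : 0 < v) : HasDerivAt (fun v => (v * cosh v - sinh v) / v ^ 3)
      ((v ^ 2 * sinh v - 3 * (v * cosh v - sinh v)) / v ^ 4) v := by
    refine ((((hasDerivAt_id v).mul (hasDerivAt_cosh v)).sub (hasDerivAt_sinh v)).div
      (hasDerivAt_pow 3 v) (by positivity)).congr_deriv ?_
    simp
    field_simp
  have h : MonotoneOn (fun v => (v * cosh v - sinh v) / v ^ 3) (Ioi 0) := by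
    refine monotoneOn_of_deriv_nonneg (convex_Ioi 0)
      (fun v hv => (hd v hv).continuousAt.continuousWithinAt)
      (fun v hv => (hd v (interior_subset hv)).differentiableAt.differentiableWithinAt)
      fun v hv => ?_
    rw [interior_Ioi] at hv
    rw [(hd v hv).deriv]
    exact div_nonneg (sq_mul_sinh_sub_nonneg (le_of_lt hv)) (by positivity)
  intro u hu v hv huv
  have hcosh : cosh u ≤ cosh v := by
    rw [cosh_le_cosh, abs_of_pos hu, abs_of_pos hv]; exact huv
  have h0 : 0 ≤ (u * cosh u - sinh u) / u ^ 3 :=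
    div_nonneg (mul_cosh_sub_sinh_pos hu).le (pow_pos hu 3).le
  have h1 := h hu hv huv
  have := cosh_pos u
  unfold energyCurv
  exact mul_le_mul (by gcongr) h1 h0 (by positivity)

theorem continuous_tangentGap : Continuous tangentGap :=
  (continuous_relEnt.mul continuous_energySlope).sub continuous_energy

theorem tangentGap_zero : tangentGap 0 = 0 := by simp [tangentGap, relEnt_zero, energy_zero]

theorem hasDerivAt_tangentGap {u : ℝ} (hu : u ≠ 0) :
    HasDerivAt tangentGap (relEnt u * (energyCurv u * (u / cosh u ^ 2))) u := by
  refine (((hasDerivAt_relEnt u).mul (hasDerivAt_energySlope hu)).sub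
    (hasDerivAt_energy u)).congr_deriv ?_
  rw [energySlope_of_ne hu]
  have hc := (cosh_pos u).ne'
  field_simp
  ring

theorem tangentGap_pos {u : ℝ} (hu : 0 < u) : 0 < tangentGap u := by
  have h : StrictMonoOn tangentGap (Ici 0) := by
    refine strictMonoOn_of_deriv_pos (convex_Ici 0) continuous_tangentGap.continuousOn
      fun v hv => ?_
    rw [interior_Ici] at hv
    rw [(hasDerivAt_tangentGap (ne_of_gt hv)).deriv]
    have := cosh_pos v
    have h1 : 0 < v := hv
    have := relEnt_pos h1
    have := energyCurv_pos h1
    positivity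
  simpa [tangentGap_zero] using h (mem_Ici.2 le_rfl) (mem_Ici.2 hu.le) hu

/-- With `x = relEnt` as variable, the gap is the integral of `x` times the second derivative of the
energy; monotonicity of the latter bounds it by its endpoint value times `x ^ 2 / 2`. -/
theorem two_mul_tangentGap_le {u : ℝ} (hu : 0 < u) :
    2 * tangentGap u ≤ energyCurv u * relEnt u ^ 2 := by
  have h : MonotoneOn (fun v => energyCurv u * relEnt v ^ 2 - 2 * tangentGap v) (Icc 0 u) := by
    have hd (v : ℝ) (hv : v ∈ Ioo 0 u) :
        HasDerivAt (fun v => energyCurv u * relEnt v ^ 2 - 2 * tangentGap v)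
          (2 * relEnt v * (v / cosh v ^ 2) * (energyCurv u - energyCurv v)) v := by
      refine ((((hasDerivAt_relEnt v).pow 2).const_mul (energyCurv u)).sub
        ((hasDerivAt_tangentGap hv.1.ne').const_mul 2)).congr_deriv ?_
      push_cast
      ring
    refine monotoneOn_of_deriv_nonneg (convex_Icc 0 u)
      (((continuous_relEnt.pow 2).const_mul _).sub
        (continuous_tangentGap.const_mul 2)).continuousOn
      (fun v hv => (hd v (by rwa [interior_Icc] at hv)).differentiableAt.differentiableWithinAt)
      fun v hv => ?_
    rw [interior_Icc] at hv
    rw [(hd v hv).deriv]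
    have := cosh_pos v
    have := hv.1
    have := relEnt_pos hv.1
    exact mul_nonneg (by positivity)
      (sub_nonneg.2 (monotoneOn_energyCurv hv.1 hu hv.2.le))
  have := h (left_mem_Icc.2 hu.le) (right_mem_Icc.2 hu.le) hu.le
  simpa [relEnt_zero, tangentGap_zero] using this

theorem ratioSlope_pos {u : ℝ} (hu : 0 < u) : 0 < ratioSlope u :=
  div_pos (tangentGap_pos hu) (pow_pos (relEnt_pos hu) 2)

theorem monotoneOn_ratioSlope : MonotoneOn ratioSlope (Ioi 0) := by
  have hd (v : ℝ) (hv : 0 < v) : HasDerivAt ratioSlope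
      ((v / cosh v ^ 2) * (energyCurv v * relEnt v ^ 2 - 2 * tangentGap v) / relEnt v ^ 3) v := by
    have hr := (relEnt_pos hv).ne'
    refine ((hasDerivAt_tangentGap hv.ne').div ((hasDerivAt_relEnt v).pow 2)
      (pow_ne_zero 2 hr)).congr_deriv ?_
    have hc := (cosh_pos v).ne'
    simp
    field_simp
  refine monotoneOn_of_deriv_nonneg (convex_Ioi 0)
    (fun v hv => (hd v hv).continuousAt.continuousWithinAt)
    (fun v hv => (hd v (interior_subset hv)).differentiableAt.differentiableWithinAt)
    fun v hv => ?_
  rw [interior_Ioi] at hv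
  rw [(hd v hv).deriv]
  have h1 : 0 < v := hv
  have := relEnt_pos h1
  have := cosh_pos v
  have := sub_nonneg.2 (two_mul_tangentGap_le h1)
  positivity

/-- `energy / relEnt` lies above its tangent lines, as a function of `relEnt`. -/
theorem ratio_support {u v : ℝ} (hu : 0 < u) (hv : 0 < v) :
    energy u / relEnt u + ratioSlope u * (relEnt v - relEnt u) ≤ energy v / relEnt v := by
  set F : ℝ → ℝ := fun w => energy w / relEnt w - ratioSlope u * relEnt w with hF
  -- The sign of this derivative is that of `ratioSlope w - ratioSlope u`, so `F` is minimal at `u`.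
  have hd (w : ℝ) (hw : 0 < w) :
      HasDerivAt F ((w / cosh w ^ 2) * (ratioSlope w - ratioSlope u)) w := by
    have hr := (relEnt_pos hw).ne'
    refine (((hasDerivAt_energy w).div (hasDerivAt_relEnt w) hr).sub
      ((hasDerivAt_relEnt w).const_mul (ratioSlope u))).congr_deriv ?_
    have hc := (cosh_pos w).ne'
    simp only [ratioSlope, tangentGap, energySlope_of_ne hw.ne']
    field_simp
  have hpos (w : ℝ) (hw : 0 < w) : 0 ≤ w / cosh w ^ 2 := by
    have := cosh_pos w
    positivity
  have key : F u ≤ F v := by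
    rcases le_total u v with huv | hvu
    · have hm : MonotoneOn F (Icc u v) := by
        refine monotoneOn_of_deriv_nonneg (convex_Icc u v)
          (fun w hw => (hd w (hu.trans_le hw.1)).continuousAt.continuousWithinAt)
          (fun w hw => (hd w (hu.trans_le
            (interior_subset hw).1)).differentiableAt.differentiableWithinAt) fun w hw => ?_
        rw [interior_Icc] at hw
        have hw0 := hu.trans hw.1
        rw [(hd w hw0).deriv]
        exact mul_nonneg (hpos w hw0) (sub_nonneg.2 (monotoneOn_ratioSlope hu hw0 hw.1.le))
      exact hm (left_mem_Icc.2 huv) (right_mem_Icc.2 huv) huv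
    · have hm : AntitoneOn F (Icc v u) := by
        refine antitoneOn_of_deriv_nonpos (convex_Icc v u)
          (fun w hw => (hd w (hv.trans_le hw.1)).continuousAt.continuousWithinAt)
          (fun w hw => (hd w (hv.trans_le
            (interior_subset hw).1)).differentiableAt.differentiableWithinAt) fun w hw => ?_
        rw [interior_Icc] at hw
        have hw0 := hv.trans hw.1
        rw [(hd w hw0).deriv]
        exact mul_nonpos_of_nonneg_of_nonpos (hpos w hw0)
          (sub_nonpos.2 (monotoneOn_ratioSlope hw0 hu hw.2.le))
      exact hm (left_mem_Icc.2 hvu) (right_mem_Icc.2 hvu) hvu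
  simp only [hF] at key
  linarith

theorem ratio_le_energySlope {u : ℝ} (hu : 0 < u) : energy u / relEnt u ≤ energySlope u := by
  rw [div_le_iff₀ (relEnt_pos hu)]
  have := tangentGap_pos hu
  unfold tangentGap at this
  linarith

/-- Comparing derivatives reduces this to `v ≤ sinh v`. -/
theorem two_le_ratio {u : ℝ} (hu : 0 < u) : 2 ≤ energy u / relEnt u := by
  rw [le_div_iff₀ (relEnt_pos hu)]
  have hd (v : ℝ) := (hasDerivAt_energy v).sub ((hasDerivAt_relEnt v).const_mul 2)
  have h : MonotoneOn (energy - fun v => 2 * relEnt v) (Ici 0) := by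
    refine monotoneOn_of_deriv_nonneg (convex_Ici 0)
      (fun v _ => (hd v).continuousAt.continuousWithinAt)
      (fun v _ => (hd v).differentiableAt.differentiableWithinAt) fun v hv => ?_
    rw [interior_Ici] at hv
    rw [(hd v).deriv, mul_div_assoc, ← mul_sub, ← sub_div]
    have := cosh_pos v
    have := sub_nonneg.2 (self_le_sinh_iff.2 (le_of_lt hv))
    positivity
  have := h (mem_Ici.2 le_rfl) (mem_Ici.2 hu.le) hu.le
  simpa [relEnt_zero, energy_zero] using this

/-! ### The inverse entropy and `C` in the parameter `u`. -/

theorem log_two_sub_mem {x : ℝ} (hx : x ∈ Icc 0 (log 2)) : log 2 - x ∈ Icc 0 (log 2) :=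
  ⟨by linarith [hx.2], by linarith [hx.1]⟩

theorem entropyInv_binEntropy {p : ℝ} (hp : p ∈ Icc (0 : ℝ) 2⁻¹) :
    entropyInv (binEntropy p) = p := by
  have h := entropyInv_spec (y := binEntropy p)
    ⟨binEntropy_nonneg hp.1 (hp.2.trans (by norm_num)), binEntropy_le_log_two⟩
  exact binEntropy_strictMonoOn.injOn h.1 hp h.2

/-- A preimage of a closed set under the inverse is the image of a compact set under `binEntropy`,
hence closed. -/
theorem continuousOn_entropyInv : ContinuousOn entropyInv (Icc 0 (log 2)) := by
  rw [continuousOn_iff_isClosed]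
  intro t ht
  refine ⟨binEntropy '' (t ∩ Icc 0 2⁻¹),
    ((isCompact_Icc.inter_left ht).image binEntropy_continuous).isClosed, ?_⟩
  ext y
  constructor
  · rintro ⟨hyt, hy⟩
    exact ⟨⟨entropyInv y, ⟨hyt, (entropyInv_spec hy).1⟩, (entropyInv_spec hy).2⟩, hy⟩
  · rintro ⟨⟨p, ⟨hpt, hp⟩, rfl⟩, hy⟩
    exact ⟨by simpa [entropyInv_binEntropy hp] using hpt, hy⟩

/-- The divergence at bias `p = (1 - tanh u) / 2`. -/
theorem relEnt_eq (u : ℝ) : relEnt u = log 2 - binEntropy ((1 - tanh u) / 2) := by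
  have hc := cosh_pos u
  have h1 : (1 - tanh u) / 2 = exp (-u) / (2 * cosh u) := by
    rw [tanh_eq_sinh_div_cosh, ← cosh_sub_sinh]; field_simp
  have h2 : 1 - (1 - tanh u) / 2 = exp u / (2 * cosh u) := by
    rw [tanh_eq_sinh_div_cosh, ← cosh_add_sinh]; field_simp; ring
  have h3 : log (exp (-u) / (2 * cosh u)) = -u - (log 2 + log (cosh u)) := by
    rw [log_div (exp_pos _).ne' (by positivity), log_exp, log_mul two_ne_zero hc.ne']
  have h4 : log (exp u / (2 * cosh u)) = u - (log 2 + log (cosh u)) := by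
    rw [log_div (exp_pos _).ne' (by positivity), log_exp, log_mul two_ne_zero hc.ne']
  rw [binEntropy, log_inv, log_inv, h2, h1, h3, h4, ← cosh_sub_sinh, ← cosh_add_sinh, relEnt]
  field_simp
  ring

theorem tanh_half_mem {u : ℝ} (hu : 0 ≤ u) : (1 - tanh u) / 2 ∈ Icc (0 : ℝ) 2⁻¹ := by
  have h1 := tanh_lt_one u
  have h2 : 0 ≤ tanh u := by
    rw [tanh_eq_sinh_div_cosh]
    exact div_nonneg (sinh_nonneg_iff.2 hu) (cosh_pos u).le
  constructor <;> linarith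

theorem entropyInv_log_two_sub_relEnt {u : ℝ} (hu : 0 ≤ u) :
    entropyInv (log 2 - relEnt u) = (1 - tanh u) / 2 := by
  rw [relEnt_eq, sub_sub_cancel, entropyInv_binEntropy (tanh_half_mem hu)]

theorem C_relEnt {u : ℝ} (hu : 0 < u) : C (relEnt u) = energy u / relEnt u := by
  have hc := cosh_pos u
  have h : (1 - tanh u) / 2 * (1 - (1 - tanh u) / 2) = (1 / (2 * cosh u)) ^ 2 := by
    rw [tanh_eq_sinh_div_cosh]
    have := cosh_sq u
    field_simp
    linear_combination this
  rw [C, if_neg (relEnt_pos hu).ne', entropyInv_log_two_sub_relEnt hu.le, h,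
    sqrt_sq (by positivity), energy]
  field_simp
  ring

/-- The parameter `u ≥ 0` with `relEnt u = x`. -/
def param (x : ℝ) : ℝ := artanh (1 - 2 * entropyInv (log 2 - x))

theorem entropyInv_mem_Ioo {y : ℝ} (hy : y ∈ Ioo 0 (log 2)) : entropyInv y ∈ Ioo (0 : ℝ) 2⁻¹ := by
  obtain ⟨⟨h0, h1⟩, h⟩ := entropyInv_spec (Ioo_subset_Icc_self hy)
  constructor
  · refine lt_of_le_of_ne h0 fun h' => hy.1.ne' ?_
    rw [← h, ← h', binEntropy_zero]
  · refine lt_of_le_of_ne h1 fun h' => hy.2.ne ?_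
    rw [← h, h', binEntropy_two_inv]

theorem param_spec {x : ℝ} (hx : x ∈ Ioo 0 (log 2)) : 0 < param x ∧ relEnt (param x) = x := by
  have hy : log 2 - x ∈ Ioo 0 (log 2) := ⟨by linarith [hx.2], by linarith [hx.1]⟩
  have hp := entropyInv_mem_Ioo hy
  have ht : 1 - 2 * entropyInv (log 2 - x) ∈ Ioo (0 : ℝ) 1 := by
    constructor <;> [linarith [hp.2]; linarith [hp.1]]
  refine ⟨artanh_pos ht, ?_⟩
  rw [relEnt_eq, param, tanh_artanh ⟨by linarith [ht.1], ht.2⟩, sub_sub_cancel,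
    mul_div_cancel_left₀ _ two_ne_zero, (entropyInv_spec (Ioo_subset_Icc_self hy)).2,
    sub_sub_cancel]

theorem C_zero : C 0 = 2 := by simp [C]

theorem log_two_pos : 0 < log 2 := log_pos one_lt_two

theorem C_log_two : C (log 2) = 2 / log 2 := by
  have h : entropyInv 0 = 0 := by
    simpa using entropyInv_binEntropy (p := 0) ⟨le_rfl, by norm_num⟩
  rw [C, if_neg log_two_pos.ne', sub_self, h]
  simp
  ring

theorem two_le_C {x : ℝ} (hx : x ∈ Ioo 0 (log 2)) : 2 ≤ C x := by
  obtain ⟨h, h'⟩ := param_spec hx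
  have := two_le_ratio h
  rwa [← C_relEnt h, h'] at this

theorem C_le_energySlope_param {x : ℝ} (hx : x ∈ Ioo 0 (log 2)) :
    C x ≤ energySlope (param x) := by
  obtain ⟨h, h'⟩ := param_spec hx
  have := ratio_le_energySlope h
  rwa [← C_relEnt h, h'] at this

theorem continuousOn_entropyInv_log_two_sub :
    ContinuousOn (fun x => entropyInv (log 2 - x)) (Icc 0 (log 2)) :=
  continuousOn_entropyInv.comp (continuous_const.sub continuous_id).continuousOn
    fun _ hx => log_two_sub_mem hx

theorem entropyInv_log_two : entropyInv (log 2) = 2⁻¹ := by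
  simpa using entropyInv_binEntropy (p := 2⁻¹) ⟨by norm_num, le_rfl⟩

theorem tendsto_C_zero : Tendsto C (𝓝[>] 0) (𝓝 2) := by
  have hmem : ∀ᶠ x in 𝓝[>] (0 : ℝ), x ∈ Ioo 0 (log 2) := Ioo_mem_nhdsGT log_two_pos
  have hinv : Tendsto (fun x => entropyInv (log 2 - x)) (𝓝[>] 0) (𝓝 2⁻¹) := by
    have h := continuousOn_entropyInv_log_two_sub 0 (left_mem_Icc.2 log_two_pos.le)
    have h' := h.mono_left (nhdsWithin_le_of_mem (s := Icc 0 (log 2)) (t := Ioi 0)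
      (Icc_mem_nhdsGT log_two_pos))
    simpa [entropyInv_log_two] using h'
  have hparam : Tendsto param (𝓝[>] 0) (𝓝 0) := by
    have hcont : ContinuousAt artanh 0 := by
      unfold artanh
      refine ContinuousAt.log (continuous_sqrt.continuousAt.comp
        (ContinuousAt.div (by fun_prop) (by fun_prop) (by norm_num))) (by norm_num)
    have h1 : Tendsto (fun x => 1 - 2 * entropyInv (log 2 - x)) (𝓝[>] 0) (𝓝 0) := by
      simpa using (hinv.const_mul 2).const_sub 1
    have h2 := hcont.tendsto.comp h1
    rwa [artanh_zero] at h2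
  have hup : Tendsto (fun x => energySlope (param x)) (𝓝[>] 0) (𝓝 2) := by
    have := (continuous_energySlope.tendsto 0).comp hparam
    rwa [energySlope_zero] at this
  exact tendsto_of_tendsto_of_tendsto_of_le_of_le' tendsto_const_nhds hup
    (hmem.mono fun x hx => two_le_C hx) (hmem.mono fun x hx => C_le_energySlope_param hx)

theorem continuousOn_C : ContinuousOn C (Icc 0 (log 2)) := by
  intro x hx
  rcases hx.1.eq_or_lt with rfl | hx0
  · have h : ContinuousWithinAt C (Ioi 0) 0 := by
      simpa only [ContinuousWithinAt, C_zero] using tendsto_C_zero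
    exact (continuousWithinAt_Ioi_iff_Ici.1 h).mono Icc_subset_Ici_self
  · have h := continuousOn_entropyInv_log_two_sub x hx
    have h2 : ContinuousWithinAt (fun x => 4 / x * (1 / 2 -
        √(entropyInv (log 2 - x) * (1 - entropyInv (log 2 - x))))) (Icc 0 (log 2)) x :=
      (continuousWithinAt_const.div continuousWithinAt_id hx0.ne').mul
        (continuousWithinAt_const.sub (h.mul (continuousWithinAt_const.sub h)).sqrt)
    refine h2.congr_of_eventuallyEq ?_ (by rw [C, if_neg hx0.ne'])
    filter_upwards [mem_nhdsWithin_of_mem_nhds (isOpen_ne.mem_nhds hx0.ne')] with y hy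
    rw [C, if_neg hy]

/-! ### Monotonicity, convexity and range of `C`. -/

/-- Every interior point of `[0, log 2]` carries a supporting line of `C` with positive slope. -/
theorem exists_support_C {x₀ : ℝ} (hx₀ : x₀ ∈ Ioo 0 (log 2)) :
    ∃ m, 0 < m ∧ ∀ x ∈ Icc 0 (log 2), C x₀ + m * (x - x₀) ≤ C x := by
  obtain ⟨hu, hu'⟩ := param_spec hx₀
  refine ⟨ratioSlope (param x₀), ratioSlope_pos hu, fun x hx => ?_⟩
  rw [← closure_Ioo log_two_pos.ne] at hx
  refine le_on_closure (f := fun x => C x₀ + ratioSlope (param x₀) * (x - x₀)) (g := C)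
    (s := Ioo 0 (log 2)) (fun y hy => ?_) (by fun_prop) ?_ hx
  · obtain ⟨hv, hv'⟩ := param_spec hy
    have := ratio_support hu hv
    rwa [← C_relEnt hu, ← C_relEnt hv, hu', hv'] at this
  · rw [closure_Ioo log_two_pos.ne]
    exact continuousOn_C

theorem strictMonoOn_C : StrictMonoOn C (Icc 0 (log 2)) := by
  have key {x y : ℝ} (hx : 0 < x) (hy : y ≤ log 2) (hxy : x < y) : C x < C y := by
    obtain ⟨m, hm, h⟩ := exists_support_C ⟨hx, hxy.trans_le hy⟩
    have := h y ⟨(hx.trans hxy).le, hy⟩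
    nlinarith [mul_pos hm (sub_pos.2 hxy)]
  intro x hx y hy hxy
  -- Support lines exist only at interior points, so the endpoint `0` is compared through `y / 2`.
  rcases hx.1.eq_or_lt with rfl | hx0
  · have hz : 0 < y / 2 := by linarith
    have h1 := two_le_C (x := y / 2) ⟨hz, by linarith [hy.2]⟩
    have h2 := key hz hy.2 (by linarith)
    rw [C_zero]
    exact h1.trans_lt h2
  · exact key hx0 hy.2 hxy

theorem convexOn_C : ConvexOn ℝ (Icc 0 (log 2)) C := by
  refine LinearOrder.convexOn_of_lt (convex_Icc _ _) fun x hx y hy hxy a b ha hb hab => ?_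
  simp only [smul_eq_mul]
  have hxz : x < a * x + b * y := by linear_combination b * hxy - x * hab
  have hzy : a * x + b * y < y := by linear_combination a * hxy + y * hab
  obtain ⟨m, -, h⟩ := exists_support_C ⟨hx.1.trans_lt hxz, hzy.trans_le hy.2⟩
  set z := a * x + b * y with hz
  have h1 := mul_le_mul_of_nonneg_left (h x hx) ha.le
  have h2 := mul_le_mul_of_nonneg_left (h y hy) hb.le
  linear_combination h1 + h2 + (C z - m * z) * (-hab) - m * hz

theorem image_C : C '' Icc 0 (log 2) = Icc 2 (2 / log 2) := by
  have h := strictMonoOn_C.monotoneOn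
  refine Subset.antisymm ?_ ?_
  · rintro _ ⟨x, hx, rfl⟩
    have hl := h (left_mem_Icc.2 log_two_pos.le) hx hx.1
    have hr := h hx (right_mem_Icc.2 log_two_pos.le) hx.2
    rw [C_zero] at hl
    rw [C_log_two] at hr
    exact ⟨hl, hr⟩
  · have := intermediate_value_Icc log_two_pos.le continuousOn_C
    rwa [C_zero, C_log_two] at this

/-! ### Splitting the cube along one coordinate. -/

theorem sum_cube_succ {n : ℕ} (g : Cube (n + 1) → ℝ) :
    ∑ x, g x = ∑ x : Cube n, g (Fin.cons false x) + ∑ x : Cube n, g (Fin.cons true x) := by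
  rw [← (Fin.consEquiv fun _ : Fin (n + 1) => Bool).sum_comp, Fintype.sum_prod_type]
  simp [Fin.consEquiv, add_comm]

theorem expect_succ {n : ℕ} (g : Cube (n + 1) → ℝ) :
    expect g = (expect (fun x : Cube n => g (Fin.cons false x)) +
      expect (fun x : Cube n => g (Fin.cons true x))) / 2 := by
  simp only [expect, sum_cube_succ, pow_succ]
  field_simp

theorem hammingDist_cons {n : ℕ} (a b : Bool) (x y : Cube n) :
    hammingDist (Fin.cons a x : Cube (n + 1)) (Fin.cons b y) =
      (if a = b then 0 else 1) + hammingDist x y := by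
  simp only [hammingDist, Finset.card_filter, Fin.sum_univ_succ, Fin.cons_zero, Fin.cons_succ]
  split_ifs <;> simp_all

theorem sum_neighbors_cons {n : ℕ} (a : Bool) (x : Cube n) (g : Cube (n + 1) → ℝ) :
    ∑ y ∈ neighbors (Fin.cons a x : Cube (n + 1)), g y =
      ∑ y ∈ neighbors x, g (Fin.cons a y) + g (Fin.cons (!a) x) := by
  simp only [neighbors, Finset.sum_filter, sum_cube_succ, hammingDist_cons]
  cases a <;> simp [add_comm]

theorem variation_succ {n : ℕ} (f : Cube (n + 1) → ℝ) :
    variation f = (variation (fun x : Cube n => f (Fin.cons false x)) +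
      variation (fun x : Cube n => f (Fin.cons true x))) / 2 +
      expect (fun x : Cube n => (f (Fin.cons false x) - f (Fin.cons true x)) ^ 2) := by
  have hsymm (x : Cube n) : (f (Fin.cons true x) - f (Fin.cons false x)) ^ 2 =
      (f (Fin.cons false x) - f (Fin.cons true x)) ^ 2 := by ring
  rw [variation, expect_succ]
  simp only [sum_neighbors_cons, variation, expect, Finset.sum_add_distrib, Bool.not_true,
    Bool.not_false, hsymm]
  ring

/-- The entropy of the function on a two-point space with values `a` and `b`. -/
def twoPointEnt (a b : ℝ) : ℝ :=
  (a * log a + b * log b) / 2 - (a + b) / 2 * log ((a + b) / 2)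

theorem ent_succ {n : ℕ} (g : Cube (n + 1) → ℝ) :
    ent g = (ent (fun x : Cube n => g (Fin.cons false x)) +
      ent (fun x : Cube n => g (Fin.cons true x))) / 2 +
      twoPointEnt (expect fun x : Cube n => g (Fin.cons false x))
        (expect fun x : Cube n => g (Fin.cons true x)) := by
  simp only [ent, twoPointEnt, expect_succ]
  ring

theorem expect_nonneg {n : ℕ} {g : Cube n → ℝ} (hg : ∀ x, 0 ≤ g x) : 0 ≤ expect g :=
  div_nonneg (Finset.sum_nonneg fun x _ => hg x) (by positivity)

theorem twoPointEnt_eq {a b : ℝ} (hab : 0 < a + b) :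
    twoPointEnt a b = (a + b) / 2 * (log 2 - binEntropy (a / (a + b))) := by
  have hlog {c : ℝ} : c / (a + b) * log (c / (a + b)) =
      c / (a + b) * (log c - log (a + b)) := by
    rcases eq_or_ne c 0 with rfl | hc
    · simp
    · rw [log_div hc hab.ne']
  have h1 : 1 - a / (a + b) = b / (a + b) := by field_simp; ring
  rw [binEntropy, h1, log_inv, log_inv, mul_neg, mul_neg, hlog, hlog, twoPointEnt,
    log_div hab.ne' two_ne_zero]
  field_simp
  ring

theorem twoPointEnt_bounds {a b : ℝ} (ha : 0 ≤ a) (hb : 0 ≤ b) :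
    0 ≤ twoPointEnt a b ∧ twoPointEnt a b ≤ (a + b) / 2 * log 2 := by
  rcases (add_nonneg ha hb).eq_or_lt with h | h
  · have ha0 : a = 0 := by linarith
    have hb0 : b = 0 := by linarith
    simp [twoPointEnt, ha0, hb0]
  · rw [twoPointEnt_eq h]
    have h1 : binEntropy (a / (a + b)) ≤ log 2 := binEntropy_le_log_two
    have h2 : 0 ≤ binEntropy (a / (a + b)) :=
      binEntropy_nonneg (by positivity) ((div_le_one h).2 (by linarith))
    exact ⟨mul_nonneg (by positivity) (by linarith),
      mul_le_mul_of_nonneg_left (by linarith) (by positivity)⟩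

theorem ent_bounds {n : ℕ} {g : Cube n → ℝ} (hg : ∀ x, 0 ≤ g x) :
    0 ≤ ent g ∧ ent g ≤ n * expect g * log 2 := by
  induction n with
  | zero => simp [ent, expect]
  | succ n ih =>
    have h0 := ih fun x => hg (Fin.cons false x)
    have h1 := ih fun x => hg (Fin.cons true x)
    have h2 := twoPointEnt_bounds (expect_nonneg fun x : Cube n => hg (Fin.cons false x))
      (expect_nonneg fun x : Cube n => hg (Fin.cons true x))
    rw [ent_succ, expect_succ]
    push_cast
    constructor
    · linarith [h0.1, h1.1, h2.1]
    · linarith [h0.2, h1.2, h2.2]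

/-! ### Affine minorants and induction on the dimension. -/

theorem mul_C_eq {x : ℝ} :
    x * C x = 4 * (1 / 2 - √(entropyInv (log 2 - x) * (1 - entropyInv (log 2 - x)))) := by
  rcases eq_or_ne x 0 with rfl | hx
  · have h : √((2 : ℝ)⁻¹ * (1 - 2⁻¹)) = 2⁻¹ := by
      rw [show (2 : ℝ)⁻¹ * (1 - 2⁻¹) = 2⁻¹ ^ 2 by norm_num, sqrt_sq (by norm_num)]
    rw [sub_zero, entropyInv_log_two, h]
    norm_num
  · rw [C, if_neg hx]
    field_simp

theorem mul_C_log_two_sub_binEntropy {p : ℝ} (hp : p ∈ Icc (0 : ℝ) 1) :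
    (log 2 - binEntropy p) * C (log 2 - binEntropy p) = 2 - 4 * √(p * (1 - p)) := by
  rw [mul_C_eq, sub_sub_cancel]
  -- Both sides are invariant under `p ↦ 1 - p`.
  rcases le_total p 2⁻¹ with h | h
  · rw [entropyInv_binEntropy ⟨hp.1, h⟩]; ring
  · rw [← binEntropy_one_sub, entropyInv_binEntropy ⟨by linarith [hp.2], by linarith⟩,
      sub_sub_cancel, mul_comm (1 - p)]
    ring

/-- The two-point inequality associated with an affine minorant of `x * C x`. -/
theorem two_point_inequality {a b : ℝ} (h : ∀ x ∈ Icc 0 (log 2), a * x + b ≤ x * C x)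
    {s t : ℝ} (hs : 0 ≤ s) (ht : 0 ≤ t) :
    a * twoPointEnt s t + b * ((s + t) / 2) ≤ (√s - √t) ^ 2 := by
  rcases (add_nonneg hs ht).eq_or_lt with h0 | hpos
  · have hs0 : s = 0 := by linarith
    have ht0 : t = 0 := by linarith
    simp [twoPointEnt, hs0, ht0]
  have hp : s / (s + t) ∈ Icc (0 : ℝ) 1 := ⟨by positivity, (div_le_one hpos).2 (by linarith)⟩
  have hx : log 2 - binEntropy (s / (s + t)) ∈ Icc 0 (log 2) :=
    log_two_sub_mem ⟨binEntropy_nonneg hp.1 hp.2, binEntropy_le_log_two⟩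
  have key := mul_le_mul_of_nonneg_left (h _ hx) (half_pos hpos).le
  rw [mul_C_log_two_sub_binEntropy hp] at key
  have hsqrt : √(s / (s + t) * (1 - s / (s + t))) = √s * √t / (s + t) := by
    rw [show s / (s + t) * (1 - s / (s + t)) = s * t / (s + t) ^ 2 by field_simp; ring,
      sqrt_div (by positivity), sqrt_sq hpos.le, sqrt_mul hs]
  rw [hsqrt] at key
  rw [twoPointEnt_eq hpos]
  have e : (s + t) / 2 * (2 - 4 * (√s * √t / (s + t))) = (√s - √t) ^ 2 := by
    have h1 := sq_sqrt hs
    have h2 := sq_sqrt ht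
    field_simp
    linear_combination -2 * h1 - 2 * h2
  linarith

/-- The reverse triangle inequality in `L²`, from Cauchy–Schwarz. -/
theorem sq_sqrt_expect_sub_le {n : ℕ} (f g : Cube n → ℝ) :
    (√(expect fun x => f x ^ 2) - √(expect fun x => g x ^ 2)) ^ 2 ≤
      expect fun x => (f x - g x) ^ 2 := by
  have hf := sq_sqrt (expect_nonneg fun x => sq_nonneg (f x))
  have hg := sq_sqrt (expect_nonneg fun x => sq_nonneg (g x))
  have hcs : expect (fun x => f x * g x) ≤
      √(expect fun x => f x ^ 2) * √(expect fun x => g x ^ 2) := by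
    simp only [expect]
    rw [sqrt_div (by positivity), sqrt_div (by positivity), div_mul_div_comm,
      mul_self_sqrt (by positivity)]
    gcongr
    exact sum_mul_le_sqrt_mul_sqrt _ _ _
  have hexp : expect (fun x => (f x - g x) ^ 2) = expect (fun x => f x ^ 2) -
      2 * expect (fun x => f x * g x) + expect (fun x => g x ^ 2) := by
    simp only [expect, sub_sq, Finset.sum_add_distrib, Finset.sum_sub_distrib, mul_assoc,
      ← Finset.mul_sum]
    ring
  rw [hexp]
  linarith

/-- An affine minorant of `x * C x` on `[0, log 2]` gives a defective logarithmic Sobolev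
inequality on every cube. -/
theorem affine_le_variation {a b : ℝ} (h : ∀ x ∈ Icc 0 (log 2), a * x + b ≤ x * C x)
    {n : ℕ} (f : Cube n → ℝ) :
    a * ent (fun x => f x ^ 2) + b * (n * expect fun x => f x ^ 2) ≤ variation f := by
  induction n with
  | zero => simp [ent, expect, variation, neighbors, hammingDist]
  | succ n ih =>
    have h0 := ih fun x => f (Fin.cons false x)
    have h1 := ih fun x => f (Fin.cons true x)
    have h2 := two_point_inequality h
      (expect_nonneg fun x : Cube n => sq_nonneg (f (Fin.cons false x)))
      (expect_nonneg fun x : Cube n => sq_nonneg (f (Fin.cons true x)))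
    have h3 := sq_sqrt_expect_sub_le (fun x : Cube n => f (Fin.cons false x))
      (fun x => f (Fin.cons true x))
    rw [ent_succ, expect_succ, variation_succ]
    push_cast
    linarith

/-! ### From tangent lines to the sharp inequality. -/

theorem exists_affine_le_mul_C {x₀ : ℝ} (hx₀ : x₀ ∈ Ioo 0 (log 2)) :
    ∃ a, 0 ≤ a ∧ ∀ x ∈ Icc 0 (log 2), a * x + (x₀ * C x₀ - a * x₀) ≤ x * C x := by
  obtain ⟨m, hm, h⟩ := exists_support_C hx₀
  have hC := two_le_C hx₀
  have hx := hx₀.1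
  -- The product rule gives this slope for `x * C x`. Multiplying the support line of `C` by `x`
  -- exceeds the tangent by `m * (x - x₀) ^ 2`.
  refine ⟨C x₀ + m * x₀, by positivity, fun x hx => ?_⟩
  have h1 := mul_le_mul_of_nonneg_left (h x hx) hx.1
  have h2 := mul_nonneg hm.le (sq_nonneg (x - x₀))
  linarith

theorem expect_sq_pos {n : ℕ} {f : Cube n → ℝ} (hf : f ≠ 0) : 0 < expect fun x => f x ^ 2 := by
  obtain ⟨x, hx⟩ := Function.ne_iff.1 hf
  refine div_pos (Finset.sum_pos' (fun y _ => sq_nonneg _) ⟨x, Finset.mem_univ x, ?_⟩)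
    (by positivity)
  exact sq_pos_of_ne_zero hx

theorem variation_nonneg {n : ℕ} (f : Cube n → ℝ) : 0 ≤ variation f :=
  expect_nonneg fun _ => Finset.sum_nonneg fun _ _ => sq_nonneg _

theorem ent_eq_rho_mul {n : ℕ} (hn : 1 ≤ n) {f : Cube n → ℝ} (hf : f ≠ 0) :
    ent (fun x => f x ^ 2) = rho f * (n * expect fun x => f x ^ 2) := by
  have h1 : (n : ℝ) ≠ 0 := by positivity
  have h2 := (expect_sq_pos hf).ne'
  rw [rho]
  field_simp

theorem rho_mem {n : ℕ} (hn : 1 ≤ n) {f : Cube n → ℝ} (hf : f ≠ 0) :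
    rho f ∈ Icc 0 (log 2) := by
  have hpos : 0 < n * expect fun x => f x ^ 2 :=
    mul_pos (by positivity) (expect_sq_pos hf)
  have h := ent_bounds fun x => sq_nonneg (f x)
  rw [ent_eq_rho_mul hn hf] at h
  exact ⟨nonneg_of_mul_nonneg_left h.1 hpos,
    le_of_mul_le_mul_right (by linarith [h.2]) hpos⟩

theorem mul_ent_le_variation {n : ℕ} (hn : 1 ≤ n) {f : Cube n → ℝ} (hf : f ≠ 0) :
    C (rho f) * ent (fun x => f x ^ 2) ≤ variation f := by
  have hrho := rho_mem hn hf
  have hM : 0 < n * expect fun x => f x ^ 2 :=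
    mul_pos (by positivity) (expect_sq_pos hf)
  rw [ent_eq_rho_mul hn hf]
  rcases hrho.1.eq_or_lt with h0 | h0
  · rw [← h0, zero_mul, mul_zero]
    exact variation_nonneg f
  -- Tangency strictly below `rho f` also covers `rho f = log 2`, where no support line is
  -- available; since `a ≥ 0`, replacing `rho f` by `x` only weakens the bound, and continuity of
  -- `C` recovers the endpoint.
  have key : ∀ x ∈ Ioo 0 (rho f), C x * (x * (n * expect fun x => f x ^ 2)) ≤ variation f := by
    intro x hx
    obtain ⟨a, ha, h⟩ := exists_affine_le_mul_C ⟨hx.1, hx.2.trans_le hrho.2⟩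
    have h1 := affine_le_variation h f
    rw [ent_eq_rho_mul hn hf] at h1
    have h2 := mul_nonneg (mul_nonneg ha (sub_nonneg.2 hx.2.le)) hM.le
    linarith
  have hmem : rho f ∈ closure (Ioo 0 (rho f)) := by
    rw [closure_Ioo h0.ne]
    exact right_mem_Icc.2 h0.le
  refine le_on_closure (f := fun x => C x * (x * (n * expect fun x => f x ^ 2)))
    (g := fun _ => variation f) key ?_ continuousOn_const hmem
  rw [closure_Ioo h0.ne]
  exact (continuousOn_C.mono (Icc_subset_Icc_right hrho.2)).mul (by fun_prop)

end HammingCube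

end

theorem theorem1p2 :
    (∀ (n : ℕ), 1 ≤ n → ∀ f : HammingCube.Cube n → ℝ, f ≠ 0 →
      HammingCube.rho f ∈ Set.Icc 0 (Real.log 2) ∧
      HammingCube.variation f ≥
        HammingCube.C (HammingCube.rho f) * HammingCube.ent (fun x => f x ^ 2)) ∧
    StrictMonoOn HammingCube.C (Set.Icc 0 (Real.log 2)) ∧
    ConvexOn ℝ (Set.Icc 0 (Real.log 2)) HammingCube.C ∧
    HammingCube.C '' Set.Icc 0 (Real.log 2) = Set.Icc 2 (2 / Real.log 2) ∧
    Filter.Tendsto HammingCube.C (𝓝[>] 0) (𝓝 2) :=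
  ⟨fun _ hn _ hf => ⟨HammingCube.rho_mem hn hf, HammingCube.mul_ent_le_variation hn hf⟩,
    HammingCube.strictMonoOn_C, HammingCube.convexOn_C, HammingCube.image_C,
    HammingCube.tendsto_C_zero⟩
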